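/- All graphs are finite and simple. A graph $G$ is $k$-vertex-critical if its chromatic number satisfies $\chi(G)=k$ but $\chi(G-v)<k$ for every vertex $v\in V(G)$. For graphs $H_1,\dots,H_r$, a graph is $(H_1,\dots,H_r)$-free if it contains no induced subgraph isomorphic to any of $H_1,\dots,H_r$. Let $P_n$ denote the path on $n$ vertices, $G+H$ the disjoint union of $G$ and $H$, and $cG$ the disjoint union of $c$ copies of $G$; the co-gem is the graph $P_4+P_1$. Theorem. For all integers $k\ge 1$ and $c\ge 0$ there are, up to isomorphism, only finitely many $k$-vertex-critical $(\text{co-gem},\,P_5,\,P_3+cP_2)$-free graphs. -/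

import Mathlib

namespace VertexCritical

/-- `G` is `k`-vertex-critical: `χ(G) = k`, but `χ(G - v) < k` for every vertex `v`. -/
def IsVertexCritical {V : Type*} (G : SimpleGraph V) (k : ℕ) : Prop :=
  G.chromaticNumber = (k : ℕ∞) ∧
    ∀ v : V, (G.induce ({v}ᶜ : Set V)).chromaticNumber < (k : ℕ∞)

/-- `G` is `H`-free: no induced subgraph of `G` is isomorphic to `H`. -/
def IsFree {W V : Type*} (H : SimpleGraph W) (G : SimpleGraph V) : Prop :=
  ¬ H.IsIndContained G

/-- `n G`, the disjoint union of `n` copies of `G`; the copies are indexed by `Fin n`. -/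
def copies {V : Type*} (n : ℕ) (G : SimpleGraph V) : SimpleGraph (Fin n × V) where
  Adj p q := p.1 = q.1 ∧ G.Adj p.2 q.2
  symm := ⟨fun _ _ h => ⟨h.1.symm, h.2.symm⟩⟩
  loopless := ⟨fun p h => G.loopless.irrefl p.2 h.2⟩

/-- The path `P_n` on `n` vertices. -/
abbrev P (n : ℕ) : SimpleGraph (Fin n) := SimpleGraph.pathGraph n

/-- The co-gem `P_4 + P_1`. -/
def coGem : SimpleGraph (Fin 4 ⊕ Fin 1) := SimpleGraph.sum (P 4) (P 1)

/-- The graph `P_3 + c P_2`. -/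
def P3PlusCopiesP2 (c : ℕ) : SimpleGraph (Fin 3 ⊕ (Fin c × Fin 2)) :=
  SimpleGraph.sum (P 3) (copies c (P 2))

end VertexCritical

/-! Criticality forbids domination (`IsVertexCritical.isUndominated`): if a homomorphic image of a
family of vertices dominated it, the family could copy the colours of its image. If the critical
graphs had unbounded order, an ultraproduct of ever larger ones would be an infinite graph
inheriting undominatedness, the forbidden induced subgraphs and the absence of a clique on `k + 1`
vertices. `finite_of_isUndominated` refutes this by infinite Ramsey arguments.

If there is no infinite induced matching, layers of half graphs can be stacked indefinitely
(`IsHalfGraphSeq.succ`), and enough layers contain a large clique. If there is one, its edges are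
cliques that can be enlarged again and again (`IsCliqueSeq.exists_succ`), up to the forbidden size.
-/

namespace VertexCritical

open SimpleGraph

/-! ### Infinite selection and forbidden induced subgraphs -/

/-- Diagonalization: if from every infinite set of indices one can select an index `i` and a label
whose relation to infinitely many of the indices holds, then this can be iterated. -/
lemma exists_strictMono_of_forall_infinite {α : Type*} (R : α → ℕ → ℕ → Prop) (T₀ : Set ℕ)
    (h₀ : T₀.Infinite)
    (h : ∀ T ⊆ T₀, T.Infinite → ∃ i ∈ T, ∃ y, {j ∈ T | R y i j}.Infinite) :
    ∃ (φ : ℕ → ℕ) (y : ℕ → α), StrictMono φ ∧ (∀ t, φ t ∈ T₀) ∧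
      ∀ s t, s < t → R (y s) (φ s) (φ t) := by
  have h' : ∀ T : {T : Set ℕ // T ⊆ T₀ ∧ T.Infinite}, ∃ i ∈ T.1, ∃ y,
      {j ∈ T.1 | R y i j}.Infinite := fun T => h T.1 T.2.1 T.2.2
  choose i hi y hy using h'
  -- Discarding the indices up to `i T` makes the selected indices strictly increasing.
  let next : {T : Set ℕ // T ⊆ T₀ ∧ T.Infinite} → {T : Set ℕ // T ⊆ T₀ ∧ T.Infinite} := fun T =>
    ⟨{j ∈ T.1 | R (y T) (i T) j} \ Set.Iic (i T),
      fun j hj => T.2.1 hj.1.1, (hy T).sdiff (Set.finite_Iic _)⟩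
  let T : ℕ → {T : Set ℕ // T ⊆ T₀ ∧ T.Infinite} := fun n => next^[n] ⟨T₀, subset_rfl, h₀⟩
  have hT : ∀ n, T (n + 1) = next (T n) := fun n => Function.iterate_succ_apply' _ _ _
  have hanti : Antitone fun n => (T n).1 := by
    refine antitone_nat_of_succ_le fun n => ?_
    rw [hT]
    exact fun j hj => hj.1.1
  have key : ∀ s t, s < t → R (y (T s)) (i (T s)) (i (T t)) ∧ i (T s) < i (T t) := by
    intro s t hst
    have h1 : i (T t) ∈ (T (s + 1)).1 := hanti (Nat.succ_le_of_lt hst) (hi (T t))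
    rw [hT] at h1
    exact ⟨h1.1.2, not_le.1 h1.2⟩
  exact ⟨fun t => i (T t), fun t => y (T t), fun s t hst => (key s t hst).2,
    fun t => (T t).2.1 (hi _), fun s t hst => (key s t hst).1⟩

variable {V : Type*} {G : SimpleGraph V}

lemma isIndContained_of_adj_iff {W : Type*} {H : SimpleGraph W} (f : W → V)
    (hf : Function.Injective f) (h : ∀ a b, G.Adj (f a) (f b) ↔ H.Adj a b) :
    H.IsIndContained G :=
  ⟨⟨⟨f, hf⟩, h _ _⟩⟩

/-- Distinctness need not be assumed: in a co-gem any two vertices are adjacent or separated by a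
third one. -/
lemma IsFree.false_of_path_add_vertex (h : IsFree coGem G) {a b c d e : V} (hab : G.Adj a b)
    (hbc : G.Adj b c) (hcd : G.Adj c d) (hac : ¬ G.Adj a c) (had : ¬ G.Adj a d)
    (hbd : ¬ G.Adj b d) (hae : ¬ G.Adj a e) (hbe : ¬ G.Adj b e) (hce : ¬ G.Adj c e)
    (hde : ¬ G.Adj d e) : False := by
  have h1 : a ≠ c := by rintro rfl; exact had hcd
  have h2 : a ≠ d := by rintro rfl; exact hbd hab.symm
  have h3 : b ≠ d := by rintro rfl; exact had hab
  have h4 : a ≠ e := by rintro rfl; exact hbe hab.symm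
  have h5 : b ≠ e := by rintro rfl; exact hae hab
  have h6 : c ≠ e := by rintro rfl; exact hbe hbc
  have h7 : d ≠ e := by rintro rfl; exact hce hcd
  have h8 := hab.ne
  have h9 := hbc.ne
  have h10 := hcd.ne
  refine h (isIndContained_of_adj_iff (Sum.elim ![a, b, c, d] ![e]) ?_ ?_)
  · rintro (i | i) (j | j) hij <;> fin_cases i <;> fin_cases j <;> simp_all
  · rintro (i | i) (j | j) <;> fin_cases i <;> fin_cases j <;>
      simp_all [coGem, P, pathGraph_adj, G.adj_comm]

lemma IsFree.false_of_path_five (h : IsFree (P 5) G) {a b c d e : V} (hab : G.Adj a b)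
    (hbc : G.Adj b c) (hcd : G.Adj c d) (hde : G.Adj d e) (hac : ¬ G.Adj a c)
    (had : ¬ G.Adj a d) (hae : ¬ G.Adj a e) (hbd : ¬ G.Adj b d) (hbe : ¬ G.Adj b e)
    (hce : ¬ G.Adj c e) : False := by
  have h1 : a ≠ c := by rintro rfl; exact had hcd
  have h2 : a ≠ d := by rintro rfl; exact hbd hab.symm
  have h3 : b ≠ d := by rintro rfl; exact had hab
  have h4 : a ≠ e := by rintro rfl; exact hbe hab.symm
  have h5 : b ≠ e := by rintro rfl; exact hae hab
  have h6 : c ≠ e := by rintro rfl; exact hbe hbc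
  have h7 := hde.ne
  have h8 := hab.ne
  have h9 := hbc.ne
  have h10 := hcd.ne
  refine h (isIndContained_of_adj_iff ![a, b, c, d, e] ?_ ?_)
  · rintro i j hij; fin_cases i <;> fin_cases j <;> simp_all
  · rintro i j; fin_cases i <;> fin_cases j <;>
      simp_all [P, pathGraph_adj, G.adj_comm]

/-- `Q` is a sequence of pairwise anticomplete cliques with `p` vertices each. -/
def IsCliqueSeq (G : SimpleGraph V) (p : ℕ) (Q : ℕ → Fin p → V) : Prop :=
  ∀ i j a b, G.Adj (Q i a) (Q j b) ↔ i = j ∧ a ≠ b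

lemma IsFree.card_lt_of_isCliqueSeq {c p : ℕ} (h : IsFree (P3PlusCopiesP2 c) G) (hp : 2 ≤ p)
    {Q : ℕ → Fin p → V} (hQ : IsCliqueSeq G p Q) {u v w : V} (huv : G.Adj u v) (hvw : G.Adj v w)
    (huw : ¬ G.Adj u w) (hne : u ≠ w) (T : Finset ℕ)
    (hT : ∀ l ∈ T, ∀ a, ¬ G.Adj u (Q l a) ∧ ¬ G.Adj v (Q l a) ∧ ¬ G.Adj w (Q l a)) :
    T.card < c := by
  by_contra! hc
  let m : Fin c → ℕ := fun i => T.orderEmbOfFin rfl (Fin.castLE hc i)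
  have hm : ∀ i, m i ∈ T := fun i => T.orderEmbOfFin_mem rfl _
  have hinj : ∀ {i j}, m i = m j ↔ i = j := by
    intro i j
    simp [m]
  let e : Fin 2 → Fin p := Fin.castLE hp
  have he : ∀ {a b}, e a = e b ↔ a = b := by intro a b; simp [e]
  have hQu : ∀ i a, ¬ G.Adj u (Q (m i) a) := fun i a => (hT _ (hm i) a).1
  have hQv : ∀ i a, ¬ G.Adj v (Q (m i) a) := fun i a => (hT _ (hm i) a).2.1
  have hQw : ∀ i a, ¬ G.Adj w (Q (m i) a) := fun i a => (hT _ (hm i) a).2.2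
  have hu : ∀ i a, u ≠ Q (m i) a := by rintro i a rfl; exact hQv i a huv.symm
  have hv : ∀ i a, v ≠ Q (m i) a := by rintro i a rfl; exact hQu i a huv
  have hw : ∀ i a, w ≠ Q (m i) a := by rintro i a rfl; exact hQv i a hvw
  have h2 : ∀ a b : Fin 2, (P 2).Adj a b ↔ a ≠ b := by
    intro a b; fin_cases a <;> fin_cases b <;> simp [P, pathGraph_adj]
  refine h (isIndContained_of_adj_iff
    (Sum.elim ![u, v, w] fun q : Fin c × Fin 2 => Q (m q.1) (e q.2)) ?_ ?_)
  · rintro (i | ⟨i, a⟩) (j | ⟨j, b⟩) hij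
    · have := huv.ne
      have := hvw.ne
      fin_cases i <;> fin_cases j <;> simp_all
    · fin_cases i <;> simp_all
    · have := fun i a => (hu i a).symm
      have := fun i a => (hv i a).symm
      have := fun i a => (hw i a).symm
      fin_cases j <;> simp_all
    · simp only [Sum.elim_inr] at hij
      obtain ⟨b', hb'⟩ : ∃ b', b' ≠ b := exists_ne b
      have h3 := (hQ (m j) (m j) (e b) (e b')).2 ⟨rfl, fun hh => hb' (he.1 hh).symm⟩
      rw [← hij] at h3
      have h4 := hinj.1 ((hQ _ _ _ _).1 h3).1
      subst h4
      have h5 : a = b := by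
        by_contra hab
        have h6 := (hQ (m i) (m i) (e a) (e b)).2 ⟨rfl, fun hh => hab (he.1 hh)⟩
        exact h6.ne hij
      rw [h5]
  · rintro (i | ⟨i, a⟩) (j | ⟨j, b⟩)
    · fin_cases i <;> fin_cases j <;>
        simp_all [P3PlusCopiesP2, P, pathGraph_adj, G.adj_comm]
    · fin_cases i <;> simp_all [P3PlusCopiesP2]
    · have := fun i a => mt (G.adj_symm (u := Q (m i) a) (v := u)) (hQu i a)
      have := fun i a => mt (G.adj_symm (u := Q (m i) a) (v := v)) (hQv i a)
      have := fun i a => mt (G.adj_symm (u := Q (m i) a) (v := w)) (hQw i a)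
      fin_cases j <;> simp_all [P3PlusCopiesP2]
    · simp only [Sum.elim_inr, P3PlusCopiesP2, sum_adj, copies, h2]
      rw [hQ]
      simp only [hinj, he, ne_eq]

/-- A sequence of vertices without arbitrarily large cliques has an independent subsequence. -/
lemma exists_strictMono_not_adj {k : ℕ} (hk : IsFree (⊤ : SimpleGraph (Fin (k + 1))) G)
    (v : ℕ → V) : ∃ φ : ℕ → ℕ, StrictMono φ ∧ ∀ s t, ¬ G.Adj (v (φ s)) (v (φ t)) := by
  have hsymm : ∀ φ : ℕ → ℕ, (∀ s t, s < t → ¬ G.Adj (v (φ s)) (v (φ t))) →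
      ∀ s t, ¬ G.Adj (v (φ s)) (v (φ t)) := by
    intro φ hφ s t hst
    rcases lt_trichotomy s t with h | h | h
    · exact hφ s t h hst
    · exact hst.ne (by rw [h])
    · exact hφ t s h hst.symm
  -- Either diagonalization builds a clique, or on some infinite `T₀` every vertex has finitely many
  -- neighbours and diagonalization builds an independent set.
  by_cases hT : ∀ T : Set ℕ, T.Infinite → ∃ i ∈ T, {j ∈ T | G.Adj (v i) (v j)}.Infinite
  · obtain ⟨φ, -, -, -, hφ⟩ := exists_strictMono_of_forall_infinite
      (fun (_ : Unit) i j => G.Adj (v i) (v j)) Set.univ Set.infinite_univ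
      fun T _ hTi => let ⟨i, hi, h⟩ := hT T hTi; ⟨i, hi, (), h⟩
    have hadj : ∀ a b : Fin (k + 1), a ≠ b → G.Adj (v (φ a)) (v (φ b)) := by
      intro a b hab
      rcases lt_or_gt_of_ne hab with h | h
      · exact hφ _ _ h
      · exact (hφ _ _ h).symm
    refine (hk (isIndContained_of_adj_iff (fun a => v (φ a)) ?_ ?_)).elim
    · intro a b hab
      by_contra hne
      exact (hadj a b hne).ne hab
    · intro a b
      rw [top_adj]
      exact ⟨fun h => by rintro rfl; exact G.loopless.irrefl _ h, hadj a b⟩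
  · push Not at hT
    obtain ⟨T₀, hT₀, hfin⟩ := hT
    obtain ⟨φ, -, hφ, -, h⟩ := exists_strictMono_of_forall_infinite
      (fun (_ : Unit) i j => ¬ G.Adj (v i) (v j)) T₀ hT₀ (by
        intro T hTs hTi
        obtain ⟨i, hi⟩ := hTi.nonempty
        refine ⟨i, hi, (), ?_⟩
        have h1 : {j ∈ T | G.Adj (v i) (v j)}.Finite :=
          (hfin i (hTs hi)).subset fun j hj => ⟨hTs hj.1, hj.2⟩
        refine (hTi.sdiff h1).mono fun j hj => ⟨hj.1, fun h => hj.2 ⟨hj.1, h⟩⟩)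
    exact ⟨φ, hφ, hsymm φ h⟩

/-- Nonadjacent vertices have nested or disjoint traces on an independent set. -/
lemma IsFree.false_of_crossing (h : IsFree (P 5) G) {x y s t u : V} (hxy : ¬ G.Adj x y)
    (hst : ¬ G.Adj s t) (hsu : ¬ G.Adj s u) (htu : ¬ G.Adj t u) (hxs : G.Adj x s)
    (hys : G.Adj y s) (hxt : G.Adj x t) (hyt : ¬ G.Adj y t) (hxu : ¬ G.Adj x u)
    (hyu : G.Adj y u) : False :=
  h.false_of_path_five hxt.symm hxs hys.symm hyu (fun h => hst h.symm) (fun h => hyt h.symm)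
    htu hxy hxu hsu

/-- Adjacent vertices have nested or covering traces on an independent set. -/
lemma IsFree.false_of_not_cover (h : IsFree coGem G) {x y t u v : V} (hxy : G.Adj x y)
    (htu : ¬ G.Adj t u) (htv : ¬ G.Adj t v) (huv : ¬ G.Adj u v) (hxt : G.Adj x t)
    (hyt : ¬ G.Adj y t) (hxu : ¬ G.Adj x u) (hyu : G.Adj y u) (hxv : ¬ G.Adj x v)
    (hyv : ¬ G.Adj y v) : False :=
  h.false_of_path_add_vertex hxt.symm hxy hyu (fun h => hyt h.symm) htu hxu htv hxv hyv huv

/-! ### Undominated graphs and private neighbours -/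

/-- No family of vertices is dominated by another one that is a homomorphic image of it. -/
def IsUndominated (G : SimpleGraph V) : Prop :=
  ∀ (p : ℕ) (f g : Fin p → V), 0 < p → (∀ a b, G.Adj (f a) (f b) → G.Adj (g a) (g b)) →
    (∀ a b, f a ≠ g b) → ∃ a x, (∀ b, x ≠ f b) ∧ G.Adj x (f a) ∧ ¬ G.Adj x (g a)

lemma IsUndominated.exists_adj_not_adj (h : IsUndominated G) {u v : V} (huv : u ≠ v) :
    ∃ x, G.Adj x u ∧ ¬ G.Adj x v := by
  obtain ⟨a, x, -, h1, h2⟩ := h 1 (fun _ => u) (fun _ => v) one_pos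
    (fun a b hab => (G.loopless.irrefl _ hab).elim) (fun _ _ => huv)
  exact ⟨x, h1, h2⟩

/-- If every trace on the independent sequence `s` is finite or everything, then each vertex of `s`
has a private neighbour, and these edges form an induced matching. -/
lemma exists_isCliqueSeq_two (hgem : IsFree coGem G) (hP5 : IsFree (P 5) G)
    (hU : IsUndominated G) {s : ℕ → V} (hs : Function.Injective s)
    (hind : ∀ i j, ¬ G.Adj (s i) (s j))
    (hfin : ∀ y i, ¬ G.Adj y (s i) → {j | G.Adj y (s j)}.Finite) :
    ∃ Q, IsCliqueSeq G 2 Q := by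
  have hsep : ∀ i j, i ≠ j → ∃ x, G.Adj x (s i) ∧ ¬ G.Adj x (s j) := fun i j hij =>
    hU.exists_adj_not_adj (hs.ne hij)
  have hpriv : ∀ i, ∃ x, ∀ j, G.Adj x (s j) ↔ j = i := by
    intro i
    have hne : ∃ n, ∃ x, G.Adj x (s i) ∧ {j | G.Adj x (s j)}.Finite ∧
        {j | G.Adj x (s j)}.ncard = n := by
      obtain ⟨x, h1, h2⟩ := hsep i (i + 1) (by omega)
      exact ⟨_, x, h1, hfin x _ h2, rfl⟩
    classical
    -- A neighbour of `s i` with smallest finite trace is private: if its trace also contained `j`,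
    -- the trace of a vertex `w` separating `i` from `j` would be strictly smaller.
    obtain ⟨x, hxi, hxf, hxn⟩ := Nat.find_spec hne
    refine ⟨x, fun j => ⟨fun hxj => ?_, fun h => h ▸ hxi⟩⟩
    by_contra hji
    obtain ⟨w, hwi, hwj⟩ := hsep i j (Ne.symm hji)
    have hwf := hfin w j hwj
    have hsub : {j | G.Adj w (s j)} ⊆ {j | G.Adj x (s j)} := by
      intro u hwu
      by_contra hxu
      by_cases hxw : G.Adj x w
      · obtain ⟨v, hv⟩ := (hxf.union hwf).infinite_compl.nonempty
        simp only [Set.mem_compl_iff, Set.mem_union, Set.mem_ofPred_eq, not_or] at hv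
        exact hgem.false_of_not_cover hxw (hind j u) (hind j v) (hind u v) hxj hwj hxu hwu
          hv.1 hv.2
      · exact hP5.false_of_crossing hxw (hind i j) (hind i u) (hind j u) hxi hwi hxj hwj hxu hwu
    have hlt : {j | G.Adj w (s j)}.ncard < {j | G.Adj x (s j)}.ncard :=
      Set.ncard_lt_ncard ⟨hsub, fun h => hwj (h hxj)⟩ hxf
    rw [hxn] at hlt
    exact Nat.find_min hne hlt ⟨w, hwi, hwf, rfl⟩
  choose x hx using hpriv
  have hxx : ∀ i j, ¬ G.Adj (x i) (x j) := by
    intro i j hij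
    have hne : i ≠ j := by rintro rfl; exact hij.ne rfl
    refine hgem.false_of_not_cover (v := s (i + j + 1)) hij (hind i j) (hind _ _) (hind _ _)
      ((hx _ _).2 rfl) ?_ ?_ ((hx _ _).2 rfl) ?_ ?_ <;> rw [hx] <;> omega
  refine ⟨fun i => ![s i, x i], fun i j a b => ?_⟩
  fin_cases a <;> fin_cases b
  · simp [hind]
  · simp [G.adj_comm (s i), hx]
  · simp [hx, eq_comm]
  · simp [hxx]

/-! ### Half graphs -/

/-- `d` infinite independent sets such that any two of them induce a half graph. -/
structure IsHalfGraphSeq (G : SimpleGraph V) (d : ℕ) (L : ℕ → ℕ → V) : Prop where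
  ne : ∀ a < d, ∀ i j, i ≠ j → L a i ≠ L a j
  not_adj : ∀ a < d, ∀ i j, ¬ G.Adj (L a i) (L a j)
  -- Adjacency on the diagonal `i = j` between layers is left open.
  adj_iff : ∀ a < d, ∀ b < a, ∀ i j, i ≠ j → (G.Adj (L a i) (L b j) ↔ i < j)

lemma IsHalfGraphSeq.comp {d : ℕ} {L : ℕ → ℕ → V} (h : IsHalfGraphSeq G d L) {φ : ℕ → ℕ}
    (hφ : StrictMono φ) : IsHalfGraphSeq G d fun a i => L a (φ i) where
  ne a ha i j hij := h.ne a ha _ _ (hφ.injective.ne hij)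
  not_adj a ha i j := h.not_adj a ha _ _
  adj_iff a ha b hb i j hij := by
    rw [h.adj_iff a ha b hb _ _ (hφ.injective.ne hij), hφ.lt_iff_lt]

/-- Every sequence of half graphs can be prolonged unless there is an infinite induced matching. -/
lemma IsHalfGraphSeq.succ {k d : ℕ} (hgem : IsFree coGem G) (hP5 : IsFree (P 5) G)
    (hk : IsFree (⊤ : SimpleGraph (Fin (k + 1))) G) (hU : IsUndominated G)
    (hQ : ¬ ∃ Q, IsCliqueSeq G 2 Q) {L : ℕ → ℕ → V} (h : IsHalfGraphSeq G (d + 1) L) :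
    ∃ L', IsHalfGraphSeq G (d + 2) L' := by
  have hstep : ∀ T ⊆ (Set.univ : Set ℕ), T.Infinite → ∃ i ∈ T, ∃ y,
      {j ∈ T | ¬ G.Adj y (L d i) ∧ ∀ b ≤ d, G.Adj y (L b j)}.Infinite := by
    intro T _ hT
    obtain ⟨φ, hφ, hφT⟩ : ∃ φ : ℕ → ℕ, StrictMono φ ∧ ∀ n, φ n ∈ T :=
      ⟨Nat.nth (· ∈ T), Nat.nth_strictMono hT, Nat.nth_mem_of_infinite hT⟩
    -- Without an infinite induced matching, some trace on the top layer is infinite but not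
    -- everything.
    obtain ⟨y, i, hyi, hinf⟩ : ∃ y i, ¬ G.Adj y (L d (φ i)) ∧
        {j | G.Adj y (L d (φ j))}.Infinite := by
      by_contra! hcon
      refine hQ (exists_isCliqueSeq_two hgem hP5 hU (s := fun j => L d (φ j)) ?_ ?_ ?_)
      · intro i j hij
        by_contra hne
        exact h.ne d (by omega) _ _ (hφ.injective.ne hne) hij
      · exact fun i j => h.not_adj d (by omega) _ _
      · exact fun y i hy => hcon y i hy
    obtain ⟨i₀, hi₀, hii₀⟩ := hinf.exists_gt i
    refine ⟨φ i, hφT i, y, ((hinf.sdiff (Set.finite_Iic i₀)).image hφ.injective.injOn).mono ?_⟩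
    rintro _ ⟨j, ⟨hj, hji⟩, rfl⟩
    simp only [Set.mem_Iic, not_le] at hji
    refine ⟨hφT j, hyi, fun b hb => ?_⟩
    rcases hb.lt_or_eq with hb | rfl
    -- Here `i < i₀ < j < i₁`, and `L b (φ j)` sees exactly the earlier vertices of layer `d`, up to
    -- the diagonal; so its trace crosses that of `y`.
    · by_contra hyb
      obtain ⟨i₁, hi₁, hji₁⟩ := hinf.exists_gt j
      have hL : ∀ u, u ≠ j → (G.Adj (L b (φ j)) (L d (φ u)) ↔ u < j) := by
        intro u hu
        rw [G.adj_comm, h.adj_iff d (by omega) b hb _ _ (hφ.injective.ne hu), hφ.lt_iff_lt]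
      have hd := h.not_adj d (by omega)
      exact hP5.false_of_crossing (x := y) (y := L b (φ j)) (s := L d (φ i₀)) (t := L d (φ i₁))
        (u := L d (φ i)) hyb (hd _ _) (hd _ _) (hd _ _) hi₀ ((hL _ hji.ne).2 hji) hi₁
        (fun hh => absurd ((hL _ hji₁.ne').1 hh) hji₁.not_gt) hyi
        ((hL _ (hii₀.trans hji).ne).2 (hii₀.trans hji))
    · exact hj
  obtain ⟨φ, y, hφ, -, hR⟩ := exists_strictMono_of_forall_infinite
    (fun (y : V) i j => ¬ G.Adj y (L d i) ∧ ∀ b ≤ d, G.Adj y (L b j)) _ Set.infinite_univ hstep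
  obtain ⟨σ, hσ, hyy⟩ := exists_strictMono_not_adj hk y
  have hL := h.comp (hφ.comp hσ)
  set M : ℕ → ℕ → V := fun a i => L a ((φ ∘ σ) i) with hM
  set z : ℕ → V := fun t => y (σ t) with hz
  have hz0 : ∀ t, ¬ G.Adj (z t) (M d t) := fun t => (hR _ _ (Nat.lt_succ_self (σ t))).1
  have hz1 : ∀ s t, s < t → ∀ b ≤ d, G.Adj (z s) (M b t) := fun s t hst => (hR _ _ (hσ hst)).2
  have hzz : ∀ s t, ¬ G.Adj (z s) (z t) := hyy
  have hd := hL.not_adj d (by omega)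
  have hz2 : ∀ s t, s < t → ¬ G.Adj (z t) (M d s) := by
    intro s t hst hadj
    exact hP5.false_of_crossing (x := z t) (y := z s) (s := M d (t + 1)) (t := M d s) (u := M d t)
      (hzz _ _) (hd _ _) (hd _ _) (hd _ _) (hz1 _ _ (by omega) _ le_rfl)
      (hz1 _ _ (by omega) _ le_rfl) hadj (hz0 s) (hz0 t) (hz1 _ _ hst _ le_rfl)
  -- `M d 0` has to be a neighbour of `M b s`, whence `0 < s`; the final layers are therefore
  -- shifted by one.
  have hz3 : ∀ b < d, ∀ s t, 0 < s → s < t → ¬ G.Adj (z t) (M b s) := by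
    intro b hb s t hs hst hadj
    have hMM : ∀ u, u ≠ s → (G.Adj (M b s) (M d u) ↔ u < s) := by
      intro u hu
      rw [G.adj_comm, hL.adj_iff d (by omega) b hb _ _ hu]
    exact hgem.false_of_not_cover (x := z t) (y := M b s) (t := M d (t + 1)) (u := M d 0)
      (v := M d t) hadj (hd _ _) (hd _ _) (hd _ _) (hz1 _ _ (by omega) _ le_rfl)
      (fun hh => absurd ((hMM _ (by omega)).1 hh) (by omega)) (hz2 _ _ (by omega))
      ((hMM _ (by omega)).2 hs) (hz0 t) (fun hh => absurd ((hMM _ (by omega)).1 hh) (by omega))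
  refine ⟨fun a i => if a = d + 1 then z (i + 1) else M a (i + 1), ⟨?_, ?_, ?_⟩⟩
  · intro a ha i j hij
    by_cases had : a = d + 1
    · simp only [had, if_true]
      intro hzij
      rcases lt_or_gt_of_ne hij with hlt | hlt
      · exact hz0 (j + 1) (hzij ▸ hz1 (i + 1) (j + 1) (by omega) d le_rfl)
      · exact hz0 (i + 1) (hzij ▸ hz1 (j + 1) (i + 1) (by omega) d le_rfl)
    · simp only [had, if_false]
      exact hL.ne a (by omega) _ _ (by omega)
  · intro a ha i j
    by_cases had : a = d + 1
    · simp only [had, if_true]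
      exact hzz _ _
    · simp only [had, if_false]
      exact hL.not_adj a (by omega) _ _
  · intro a ha b hb i j hij
    have hbd : b ≠ d + 1 := by omega
    by_cases had : a = d + 1
    · simp only [had, if_true, hbd, if_false]
      refine ⟨fun hadj => ?_, fun hlt => hz1 _ _ (by omega) b (by omega)⟩
      by_contra hlt
      rcases (show b ≤ d by omega).lt_or_eq with hb' | rfl
      · exact hz3 b hb' _ _ (by omega) (by omega) hadj
      · exact hz2 _ _ (by omega) hadj
    · simp only [had, if_false, hbd]
      rw [hL.adj_iff a (by omega) b hb _ _ (by omega)]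
      omega

lemma exists_infinite_induced_matching [Infinite V] {k : ℕ} (hgem : IsFree coGem G)
    (hP5 : IsFree (P 5) G) (hk : IsFree (⊤ : SimpleGraph (Fin (k + 1))) G)
    (hU : IsUndominated G) : ∃ Q, IsCliqueSeq G 2 Q := by
  by_contra hQ
  have hL : ∀ d, ∃ L, IsHalfGraphSeq G (d + 1) L := by
    intro d
    induction d with
    | zero =>
      obtain ⟨φ, hφ, hind⟩ := exists_strictMono_not_adj hk (Infinite.natEmbedding V)
      refine ⟨fun _ i => Infinite.natEmbedding V (φ i), ⟨?_, ?_, ?_⟩⟩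
      · exact fun _ _ i j hij => (Infinite.natEmbedding V).injective.ne (hφ.injective.ne hij)
      · exact fun _ _ => hind
      · intro a ha b hb
        omega
    | succ d ih =>
      obtain ⟨L, hL⟩ := ih
      exact hL.succ hgem hP5 hk hU hQ
  obtain ⟨L, hL⟩ := hL k
  -- Indices decrease as the layer rises, so one vertex per layer yields a clique.
  have hadj : ∀ a b : Fin (k + 1), b < a → G.Adj (L a (k - a)) (L b (k - b)) := by
    intro a b hab
    have := a.2
    have : (b : ℕ) < a := hab
    exact (hL.adj_iff a (by omega) b (by omega) _ _ (by omega)).2 (by omega)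
  have hadj' : ∀ a b : Fin (k + 1), a ≠ b → G.Adj (L a (k - a)) (L b (k - b)) := by
    intro a b hab
    rcases lt_or_gt_of_ne hab with hlt | hlt
    · exact (hadj b a hlt).symm
    · exact hadj a b hlt
  refine hk (isIndContained_of_adj_iff (fun a : Fin (k + 1) => L a (k - a)) ?_ ?_)
  · intro a b hab
    by_contra hne
    exact (hadj' a b hne).ne hab
  · intro a b
    rw [top_adj]
    exact ⟨fun h => by rintro rfl; exact G.loopless.irrefl _ h, hadj' a b⟩

/-! ### Enlarging anticomplete cliques -/

lemma IsCliqueSeq.adj {p : ℕ} {Q : ℕ → Fin p → V} (hQ : IsCliqueSeq G p Q) {i : ℕ} {a b : Fin p}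
    (hab : a ≠ b) : G.Adj (Q i a) (Q i b) :=
  (hQ _ _ _ _).2 ⟨rfl, hab⟩

lemma IsCliqueSeq.not_adj {p : ℕ} {Q : ℕ → Fin p → V} (hQ : IsCliqueSeq G p Q) {i j : ℕ}
    (hij : i ≠ j) (a b : Fin p) : ¬ G.Adj (Q i a) (Q j b) :=
  fun h => hij ((hQ _ _ _ _).1 h).1

/-- A vertex that is mixed on one clique and has a neighbour in another one is complete to all
cliques but the first. -/
lemma IsCliqueSeq.adj_of_mixed {p : ℕ} (hgem : IsFree coGem G) {Q : ℕ → Fin p → V}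
    (hQ : IsCliqueSeq G p Q) {x : V} {i j : ℕ} {a b e : Fin p} (hij : i ≠ j)
    (ha : G.Adj x (Q i a)) (hb : ¬ G.Adj x (Q i b)) (he : G.Adj x (Q j e)) (l : ℕ) (hl : i ≠ l)
    (d : Fin p) : G.Adj x (Q l d) := by
  have key : ∀ j e l d, i ≠ j → G.Adj x (Q j e) → i ≠ l → j ≠ l → G.Adj x (Q l d) := by
    intro j e l d hij he hil hjl
    by_contra hd
    have hba : b ≠ a := by rintro rfl; exact hb ha
    exact hgem.false_of_path_add_vertex (hQ.adj hba) ha.symm he (fun h => hb h.symm)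
      (hQ.not_adj hij _ _) (hQ.not_adj hij _ _) (hQ.not_adj hil _ _) (hQ.not_adj hil _ _) hd
      (hQ.not_adj hjl _ _)
  -- For `l = j`, a third clique first takes over the role of clique `j`.
  by_cases hjl : j = l
  · have h1 := key j e (i + j + 1) e hij he (by omega) (by omega)
    exact key (i + j + 1) e l d (by omega) h1 hl (by omega)
  · exact key j e l d hij he hl hjl

/-- A vertex outside an infinite induced family of cliques with a neighbour in one of them is either
complete to this one and anticomplete to the others, or complete to all but at most `c + 1`. -/
lemma IsCliqueSeq.complete_or_card_le {p c : ℕ} (hp : 2 ≤ p) (hgem : IsFree coGem G)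
    (hP3 : IsFree (P3PlusCopiesP2 c) G) {Q : ℕ → Fin p → V}
    (hQ : IsCliqueSeq G p Q) {x : V} (hx : ∀ i a, x ≠ Q i a) {i : ℕ} {a : Fin p}
    (ha : G.Adj x (Q i a)) :
    ((∀ b, G.Adj x (Q i b)) ∧ ∀ l, i ≠ l → ∀ d, ¬ G.Adj x (Q l d)) ∨
      ∀ T : Finset ℕ, (∀ l ∈ T, ∃ d, ¬ G.Adj x (Q l d)) → T.card ≤ c + 1 := by
  by_cases hj : ∃ j, i ≠ j ∧ ∃ e, G.Adj x (Q j e)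
  · right
    obtain ⟨j, hij, e, he⟩ := hj
    intro T hT
    -- If `x` is mixed on a clique, that is the only exception. Otherwise every exception is
    -- anticomplete to `x`, hence to the induced path `Q i a`, `x`, `Q j e`, and there are fewer
    -- than `c` of them.
    by_cases hmix : ∃ l b d, G.Adj x (Q l b) ∧ ¬ G.Adj x (Q l d)
    · obtain ⟨l, b, d, hb, hd⟩ := hmix
      obtain ⟨m, e', hlm, he'⟩ : ∃ m e', l ≠ m ∧ G.Adj x (Q m e') := by
        by_cases hli : l = i
        · exact ⟨j, e, by omega, he⟩
        · exact ⟨i, a, hli, ha⟩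
      have hTl : T ⊆ {l} := by
        intro l' hl'
        obtain ⟨d', hd'⟩ := hT l' hl'
        rw [Finset.mem_singleton]
        by_contra hne
        exact hd' (hQ.adj_of_mixed hgem hlm hb hd he' l' (Ne.symm hne) d')
      have := Finset.card_le_card hTl
      rw [Finset.card_singleton] at this
      omega
    · push Not at hmix
      have hnot : ∀ l ∈ T, ∀ d, ¬ G.Adj x (Q l d) := fun l hl d hd =>
        let ⟨d', hd'⟩ := hT l hl
        hd' (hmix l d d' hd)
      have hTi : ∀ l ∈ T, i ≠ l := by rintro l hl rfl; exact hnot _ hl a ha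
      have hTj : ∀ l ∈ T, j ≠ l := by rintro l hl rfl; exact hnot _ hl e he
      have := hP3.card_lt_of_isCliqueSeq hp hQ ha.symm he (hQ.not_adj hij _ _)
        (fun h => by
          obtain ⟨b, hb⟩ : ∃ b, b ≠ a := by
            have : Nontrivial (Fin p) := Fin.nontrivial_iff_two_le.2 hp
            exact exists_ne a
          exact hQ.not_adj hij.symm e b (h ▸ hQ.adj hb.symm)) T
        fun l hl d => ⟨hQ.not_adj (hTi l hl) _ _, hnot l hl d, hQ.not_adj (hTj l hl) _ _⟩
      omega
  · left
    push Not at hj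
    refine ⟨fun b => ?_, hj⟩
    by_contra hb
    have hab : a ≠ b := by rintro rfl; exact hb ha
    have := hP3.card_lt_of_isCliqueSeq hp hQ ha (hQ.adj hab) hb (hx i b)
      (Finset.Ioc i (i + c)) fun l hl d => by
        have hil : i ≠ l := (Finset.mem_Ioc.1 hl).1.ne
        exact ⟨hj l hil d, hQ.not_adj hil _ _, hQ.not_adj hil _ _⟩
    simp at this

/-- The cliques of an infinite induced family can be enlarged by one vertex each, after passing to
an infinite subfamily. -/
lemma IsCliqueSeq.exists_succ {k p c : ℕ} (hp : 2 ≤ p) (hgem : IsFree coGem G)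
    (hP5 : IsFree (P 5) G) (hP3 : IsFree (P3PlusCopiesP2 c) G)
    (hk : IsFree (⊤ : SimpleGraph (Fin (k + 1))) G) (hU : IsUndominated G)
    {Q : ℕ → Fin p → V} (hQ : IsCliqueSeq G p Q) : ∃ Q', IsCliqueSeq G (p + 1) Q' := by
  -- `J` holds the cliques with a private complete vertex. If it is infinite, these vertices are
  -- added; otherwise undominatedness between cliques outside `J` gives vertices complete to almost
  -- all cliques.
  let J : Set ℕ := {i | ∃ x, (∀ b, G.Adj x (Q i b)) ∧ ∀ l, i ≠ l → ∀ d, ¬ G.Adj x (Q l d)}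
  let e₀ : Fin p := ⟨0, by omega⟩
  by_cases hJ : J.Infinite
  · obtain ⟨φ, hφ, hφJ⟩ : ∃ φ : ℕ → ℕ, StrictMono φ ∧ ∀ n, φ n ∈ J :=
      ⟨Nat.nth (· ∈ J), Nat.nth_strictMono hJ, Nat.nth_mem_of_infinite hJ⟩
    choose x hx1 hx2 using hφJ
    have hx : ∀ i j b, G.Adj (x i) (Q (φ j) b) ↔ i = j := fun i j b =>
      ⟨fun h => by
        by_contra hij
        exact hx2 i _ (hφ.injective.ne hij) b h, fun h => h ▸ hx1 i b⟩
    have hxx : ∀ i j, ¬ G.Adj (x i) (x j) := by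
      intro i j hij
      have hne : i ≠ j := by rintro rfl; exact hij.ne rfl
      have hQn : ∀ u v, u ≠ v → ¬ G.Adj (Q (φ u) e₀) (Q (φ v) e₀) := fun u v huv =>
        hQ.not_adj (hφ.injective.ne huv) _ _
      refine hgem.false_of_not_cover (v := Q (φ (i + j + 1)) e₀) hij (hQn i j hne)
        (hQn _ _ (by omega)) (hQn _ _ (by omega))
        ((hx _ _ _).2 rfl) ?_ ?_ ((hx _ _ _).2 rfl) ?_ ?_ <;> rw [hx] <;> omega
    refine ⟨fun i => Fin.cons (x i) (Q (φ i)), fun i j a b => ?_⟩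
    refine Fin.cases ?_ (fun a => ?_) a <;> refine Fin.cases ?_ (fun b => ?_) b
    · simp [hxx]
    · simp [hx, eq_comm]
    · simp [G.adj_comm (Q _ _), hx, eq_comm]
    · simp only [Fin.cons_succ, ne_eq, Fin.succ_inj]
      rw [hQ, hφ.injective.eq_iff]
  · exfalso
    rw [Set.not_infinite] at hJ
    let R : V → ℕ → ℕ → Prop := fun x i l => (∃ b, ¬ G.Adj x (Q i b)) ∧
      (∀ d, G.Adj x (Q l d)) ∧
      ∀ T : Finset ℕ, (∀ l ∈ T, ∃ d, ¬ G.Adj x (Q l d)) → T.card ≤ c + 1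
    have hstep : ∀ T ⊆ Jᶜ, T.Infinite → ∃ i ∈ T, ∃ y, {j ∈ T | R y i j}.Infinite := by
      intro T hTJ hT
      obtain ⟨i, hi⟩ := hT.nonempty
      obtain ⟨j, hj, hij⟩ := hT.exists_gt i
      obtain ⟨a, x, hxj, hxa, hxi⟩ := hU p (Q j) (Q i) (by omega)
        (fun a b hab => (hQ _ _ _ _).2 ⟨rfl, ((hQ _ _ _ _).1 hab).2⟩)
        (fun a b h => by
          obtain ⟨a', ha'⟩ : ∃ b, b ≠ a := by
            have : Nontrivial (Fin p) := Fin.nontrivial_iff_two_le.2 hp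
            exact exists_ne a
          exact hQ.not_adj hij.ne b a' (h ▸ hQ.adj ha'.symm))
      have hx : ∀ l b, x ≠ Q l b := by
        intro l b hxl
        have h1 := ((hQ _ _ _ _).1 (hxl ▸ hxa)).1
        exact hxj b (h1 ▸ hxl)
      have hcard := (hQ.complete_or_card_le hp hgem hP3 hx hxa).resolve_left
        fun h => hTJ hj ⟨x, h⟩
      refine ⟨i, hi, x, ?_⟩
      have hfin : {l | ∃ d, ¬ G.Adj x (Q l d)}.Finite := by
        by_contra hinf
        obtain ⟨T', hT', hcard'⟩ := Set.Infinite.exists_subset_card_eq hinf (c + 2)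
        have := hcard T' fun l hl => hT' hl
        omega
      refine (hT.sdiff hfin).mono fun l hl => ⟨hl.1, ⟨a, hxi⟩, ?_, hcard⟩
      by_contra! h
      exact hl.2 h
    obtain ⟨φ, x, hφ, -, hR⟩ := exists_strictMono_of_forall_infinite R _ hJ.infinite_compl hstep
    obtain ⟨σ, hσ, hxx⟩ := exists_strictMono_not_adj hk x
    have hb : ∀ t, ∃ b, ¬ G.Adj (x (σ t)) (Q (φ (σ t)) b) :=
      fun t => (hR _ _ (Nat.lt_succ_self _)).1
    choose b hb using hb
    have hadj : ∀ s t, s < t → ∀ d, G.Adj (x (σ s)) (Q (φ (σ t)) d) :=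
      fun s t hst => (hR _ _ (hσ hst)).2.1
    have hQn : ∀ s t, s ≠ t → ∀ d e, ¬ G.Adj (Q (φ (σ s)) d) (Q (φ (σ t)) e) :=
      fun s t hst => hQ.not_adj ((hφ.comp hσ).injective.ne hst)
    have hnot : ∀ s t, s < t → ¬ G.Adj (x (σ t)) (Q (φ (σ s)) (b s)) := by
      intro s t hst h
      exact hP5.false_of_crossing (x := x (σ t)) (y := x (σ s)) (s := Q (φ (σ (t + 1))) e₀)
        (t := Q (φ (σ s)) (b s)) (u := Q (φ (σ t)) (b t)) (hxx _ _) (hQn _ _ (by omega) _ _)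
        (hQn _ _ (by omega) _ _) (hQn _ _ (by omega) _ _) (hadj _ _ (by omega) _)
        (hadj _ _ (by omega) _) h (hb s) (hb t) (hadj _ _ hst _)
    -- By `hnot`, this vertex is not complete to any of the `c + 2` preceding cliques, one more than
    -- allowed.
    have hcard := (hR _ _ (Nat.lt_succ_self (σ (c + 2)))).2.2
      ((Finset.range (c + 2)).image (φ ∘ σ)) fun l hl => by
        obtain ⟨s, hs, rfl⟩ := Finset.mem_image.1 hl
        exact ⟨b s, hnot s _ (Finset.mem_range.1 hs)⟩
    rw [Finset.card_image_of_injective _ (hφ.comp hσ).injective, Finset.card_range] at hcard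
    omega

/-- An undominated (co-gem, `P₅`, `P₃ + c P₂`)-free graph of bounded clique number is finite. -/
lemma finite_of_isUndominated {k c : ℕ} (hgem : IsFree coGem G)
    (hP5 : IsFree (P 5) G) (hP3 : IsFree (P3PlusCopiesP2 c) G)
    (hk : IsFree (⊤ : SimpleGraph (Fin (k + 1))) G) (hU : IsUndominated G) : Finite V := by
  by_contra hV
  rw [not_finite_iff_infinite] at hV
  have h : ∀ p, ∃ Q, IsCliqueSeq G (p + 2) Q := by
    intro p
    induction p with
    | zero => exact exists_infinite_induced_matching hgem hP5 hk hU
    | succ p ih =>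
      obtain ⟨Q, hQ⟩ := ih
      exact hQ.exists_succ (by omega) hgem hP5 hP3 hk hU
  obtain ⟨Q, hQ⟩ := h k
  let e : Fin (k + 1) → Fin (k + 2) := Fin.castSucc
  have he : ∀ a b, G.Adj (Q 0 (e a)) (Q 0 (e b)) ↔ a ≠ b := by
    intro a b
    rw [hQ]
    simp [e]
  refine hk (isIndContained_of_adj_iff (fun a => Q 0 (e a)) ?_ fun a b => by rw [he, top_adj])
  intro a b hab
  by_contra hne
  exact ((he a b).2 hne).ne hab

end VertexCritical

/-! ### Ultraproducts of graphs -/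

namespace VertexCritical

open SimpleGraph Filter

section Ultraproduct

variable {V : ℕ → Type*}

/-- The ultraproduct of a sequence of graphs. -/
def ultraproduct (U : Ultrafilter ℕ) (G : ∀ n, SimpleGraph (V n)) :
    SimpleGraph ((U : Filter ℕ).Product V) where
  Adj x y := ∀ᶠ n in U, (G n).Adj (Quotient.out x n) (Quotient.out y n)
  symm := ⟨fun _ _ h => h.mono fun _ hn => hn.symm⟩
  loopless := ⟨fun x h => by
    obtain ⟨n, hn⟩ := h.exists
    exact (G n).loopless.irrefl _ hn⟩

variable {U : Ultrafilter ℕ} {G : ∀ n, SimpleGraph (V n)}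

lemma eventually_out_eq (f : ∀ n, V n) :
    ∀ᶠ n in U, Quotient.out (Quotient.mk (productSetoid (U : Filter ℕ) V) f) n = f n :=
  Quotient.mk_out (s := productSetoid (U : Filter ℕ) V) f

lemma eventually_out_ne {x y : (U : Filter ℕ).Product V} (h : x ≠ y) :
    ∀ᶠ n in U, Quotient.out x n ≠ Quotient.out y n := by
  refine Ultrafilter.eventually_not.2 fun hxy => h ?_
  exact Quotient.out_equiv_out.1 hxy

lemma eventually_adj_iff (x y : (U : Filter ℕ).Product V) :
    ∀ᶠ n in U, ((G n).Adj (Quotient.out x n) (Quotient.out y n) ↔ (ultraproduct U G).Adj x y) := by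
  by_cases h : (ultraproduct U G).Adj x y
  · exact h.mono fun n hn => iff_of_true hn h
  · exact (Ultrafilter.eventually_not.2 h).mono fun n hn => iff_of_false hn h

/-- As `H` is finite, a copy of it is described by finitely many conditions, which hold together in
some factor. -/
lemma IsFree.ultraproduct {W : Type*} [Finite W] {H : SimpleGraph W} (h : ∀ n, IsFree H (G n)) :
    IsFree H (ultraproduct U G) := by
  rintro ⟨e⟩
  have h1 : ∀ᶠ n in U, ∀ a b, (G n).Adj (Quotient.out (e a) n) (Quotient.out (e b) n) ↔
      H.Adj a b := by
    refine eventually_all.2 fun a => eventually_all.2 fun b => ?_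
    simpa only [e.map_adj_iff] using eventually_adj_iff (G := G) (e a) (e b)
  have h2 : ∀ᶠ n in U, ∀ a b, a ≠ b → Quotient.out (e a) n ≠ Quotient.out (e b) n := by
    refine eventually_all.2 fun a => eventually_all.2 fun b => ?_
    by_cases hab : a = b
    · simp [hab]
    · exact (eventually_out_ne (e.injective.ne hab)).mono fun n hn _ => hn
  obtain ⟨n, hn1, hn2⟩ := (h1.and h2).exists
  refine h n (isIndContained_of_adj_iff (fun a => Quotient.out (e a) n) ?_ hn1)
  intro a b hab
  by_contra hne
  exact hn2 a b hne hab

lemma IsUndominated.ultraproduct (h : ∀ n, IsUndominated (G n)) :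
    IsUndominated (ultraproduct U G) := by
  intro p f g hp hfg hne
  have h1 : ∀ᶠ n in U, ∀ a b, (G n).Adj (Quotient.out (f a) n) (Quotient.out (f b) n) →
      (G n).Adj (Quotient.out (g a) n) (Quotient.out (g b) n) := by
    refine eventually_all.2 fun a => eventually_all.2 fun b => ?_
    filter_upwards [eventually_adj_iff (G := G) (f a) (f b),
      eventually_adj_iff (G := G) (g a) (g b)] with n hn1 hn2
    rw [hn1, hn2]
    exact hfg a b
  have h2 : ∀ᶠ n in U, ∀ a b, Quotient.out (f a) n ≠ Quotient.out (g b) n :=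
    eventually_all.2 fun a => eventually_all.2 fun b => eventually_out_ne (hne a b)
  have h3 : ∀ᶠ n in U, ∃ a ∈ (Set.univ : Set (Fin p)), ∃ x, (∀ b, x ≠ Quotient.out (f b) n) ∧
      (G n).Adj x (Quotient.out (f a) n) ∧ ¬ (G n).Adj x (Quotient.out (g a) n) := by
    filter_upwards [h1, h2] with n hn1 hn2
    obtain ⟨a, x, hx⟩ := h n p (fun a => Quotient.out (f a) n) (fun a => Quotient.out (g a) n)
      hp hn1 hn2
    exact ⟨a, trivial, x, hx⟩
  -- The index `a` may vary with the factor; among finitely many values the ultrafilter selects one.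
  obtain ⟨a, -, ha⟩ := (Ultrafilter.eventually_exists_mem_iff Set.finite_univ).1 h3
  let x : ∀ n, V n := fun n => Classical.epsilon (h := ⟨Quotient.out (f a) n⟩) fun x =>
    (∀ b, x ≠ Quotient.out (f b) n) ∧
      (G n).Adj x (Quotient.out (f a) n) ∧ ¬ (G n).Adj x (Quotient.out (g a) n)
  have hx : ∀ᶠ n in U, (∀ b, x n ≠ Quotient.out (f b) n) ∧
      (G n).Adj (x n) (Quotient.out (f a) n) ∧ ¬ (G n).Adj (x n) (Quotient.out (g a) n) :=
    ha.mono fun n hn => Classical.epsilon_spec hn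
  let y : (U : Filter ℕ).Product V := Quotient.mk (productSetoid (U : Filter ℕ) V) x
  have hy : ∀ᶠ n in U, Quotient.out y n = x n := eventually_out_eq x
  refine ⟨a, y, fun b hb => ?_, ?_, fun hadj => ?_⟩
  · obtain ⟨n, hn1, hn2⟩ := (hx.and hy).exists
    exact hn1.1 b (by rw [← hn2, hb])
  · filter_upwards [hx, hy] with n hn1 hn2
    rw [hn2]
    exact hn1.2.1
  · obtain ⟨n, ⟨hn1, hn2⟩, hn3⟩ := ((hx.and hy).and hadj).exists
    rw [hn2] at hn3
    exact hn1.2.2 hn3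

lemma infinite_product (hV : ∀ n, Finite (V n)) (hcard : ∀ n, n < Nat.card (V n)) :
    Infinite ((hyperfilter ℕ : Filter ℕ).Product V) := by
  have hemb : ∀ n, Nonempty (Fin n ↪ V n) := fun n => by
    have := Fintype.ofFinite (V n)
    refine Function.Embedding.nonempty_of_card_le ?_
    rw [Fintype.card_fin, ← Nat.card_eq_fintype_card]
    exact (hcard n).le
  have hne : ∀ n, Nonempty (V n) := fun n =>
    (Nat.card_pos_iff.1 (Nat.zero_le n |>.trans_lt (hcard n))).1
  -- Only factors with `n > m` matter; the other coordinates are arbitrary.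
  let x : ℕ → ∀ n, V n := fun m n => if h : m < n then (hemb n).some ⟨m, h⟩ else (hne n).some
  refine Infinite.of_injective
    (fun m => Quotient.mk (productSetoid (hyperfilter ℕ : Filter ℕ) V) (x m)) ?_
  intro i j hij
  have h1 : ∀ᶠ n in hyperfilter ℕ, x i n = x j n := Quotient.exact hij
  have h2 : ∀ᶠ n in hyperfilter ℕ, i + j < n :=
    Nat.hyperfilter_le_atTop (eventually_gt_atTop (i + j))
  obtain ⟨n, hn1, hn2⟩ := (h1.and h2).exists
  have hi : i < n := by omega
  have hj : j < n := by omega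
  simpa [x, hi, hj] using hn1

end Ultraproduct

/-! ### Properties of vertex-critical graphs -/

section Critical

variable {V : Type*} {G : SimpleGraph V} {k : ℕ}

lemma IsVertexCritical.isFree_top (h : IsVertexCritical G k) :
    IsFree (⊤ : SimpleGraph (Fin (k + 1))) G := by
  intro he
  have hc : G.Colorable k := chromaticNumber_le_iff_colorable.1 h.1.le
  exact he.isContained.not_cliqueFree (hc.cliqueFree (Nat.lt_succ_self k))

lemma IsVertexCritical.isUndominated (h : IsVertexCritical G k) : IsUndominated G := by
  intro p f g hp hfg hne
  by_contra! hcon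
  obtain ⟨m, hm⟩ := ENat.ne_top_iff_exists.1 (h.2 (f ⟨0, hp⟩)).ne_top
  have hmk : m < k := by
    have := h.2 (f ⟨0, hp⟩)
    rw [← hm] at this
    exact_mod_cast this
  obtain ⟨C⟩ := chromaticNumber_le_iff_colorable.1 hm.ge
  classical
  have hg : ∀ a, g a ∈ ({f ⟨0, hp⟩}ᶜ : Set V) := fun a => (hne _ a).symm
  have hv : ∀ v, (¬ ∃ a, f a = v) → v ∈ ({f ⟨0, hp⟩}ᶜ : Set V) := fun v hv hv0 =>
    hv ⟨_, hv0.symm⟩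
  -- Every vertex of the family `f` takes the colour of its image under `g`, which the deletion of
  -- `f 0` does not affect.
  let c : V → Fin m := fun v => if hf : ∃ a, f a = v then C ⟨g hf.choose, hg _⟩ else C ⟨v, hv v hf⟩
  have hvalid : ∀ {x y : V} (hx : x ∈ ({f ⟨0, hp⟩}ᶜ : Set V)) (hy : y ∈ ({f ⟨0, hp⟩}ᶜ : Set V)),
      G.Adj x y → C ⟨x, hx⟩ ≠ C ⟨y, hy⟩ := fun hx hy hxy => C.valid hxy
  have hc : ∀ x y, G.Adj x y → c x ≠ c y := by
    intro x y hxy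
    by_cases hx : ∃ a, f a = x <;> by_cases hy : ∃ a, f a = y <;> simp only [c, hx, hy, dif_pos,
      dif_neg, not_false_eq_true]
    · exact hvalid _ _ (hfg _ _ (by rwa [hx.choose_spec, hy.choose_spec]))
    · exact hvalid _ _ (hcon hx.choose y (fun b hb => hy ⟨b, hb.symm⟩)
        (by rw [hx.choose_spec]; exact hxy.symm)).symm
    · exact hvalid _ _ (hcon hy.choose x (fun b hb => hx ⟨b, hb.symm⟩)
        (by rw [hy.choose_spec]; exact hxy))
    · exact hvalid _ _ hxy
  have hle : G.chromaticNumber ≤ m :=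
    Colorable.chromaticNumber_le ⟨Coloring.mk c fun {x y} hxy => hc x y hxy⟩
  rw [h.1] at hle
  have : k ≤ m := by exact_mod_cast hle
  omega

end Critical

end VertexCritical

theorem theorem3p1 (k c : ℕ) (hk : 1 ≤ k) :
    ∃ F : Finset (Σ n : ℕ, SimpleGraph (Fin n)),
      ∀ (V : Type*) [Finite V] (G : SimpleGraph V),
        VertexCritical.IsVertexCritical G k →
        VertexCritical.IsFree VertexCritical.coGem G →
        VertexCritical.IsFree (VertexCritical.P 5) G →
        VertexCritical.IsFree (VertexCritical.P3PlusCopiesP2 c) G →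
        ∃ H ∈ F, Nonempty (G ≃g H.2) := by
  classical
  -- A bound on the order suffices: there are finitely many graphs on each `Fin n`.
  obtain ⟨N, hN⟩ : ∃ N : ℕ, ∀ (V : Type _) [Finite V] (G : SimpleGraph V),
      VertexCritical.IsVertexCritical G k → VertexCritical.IsFree VertexCritical.coGem G →
      VertexCritical.IsFree (VertexCritical.P 5) G →
      VertexCritical.IsFree (VertexCritical.P3PlusCopiesP2 c) G → Nat.card V ≤ N := by
    by_contra! hcon
    choose V hV G hcrit hgem hP5 hP3 hcard using hcon
    have := VertexCritical.infinite_product hV hcard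
    have hfin := VertexCritical.finite_of_isUndominated
      (VertexCritical.IsFree.ultraproduct (U := Filter.hyperfilter ℕ) hgem)
      (VertexCritical.IsFree.ultraproduct hP5) (VertexCritical.IsFree.ultraproduct hP3)
      (VertexCritical.IsFree.ultraproduct fun n => (hcrit n).isFree_top)
      (VertexCritical.IsUndominated.ultraproduct fun n => (hcrit n).isUndominated)
    exact not_finite_iff_infinite.2 this hfin
  refine ⟨(Finset.range (N + 1)).sigma fun n => Finset.univ, ?_⟩
  intro V _ G h1 h2 h3 h4
  have := Fintype.ofFinite V
  have hcard := hN V G h1 h2 h3 h4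
  rw [Nat.card_eq_fintype_card] at hcard
  exact ⟨⟨Fintype.card V, G.overFin rfl⟩, by simpa using hcard, ⟨G.overFinIso rfl⟩⟩
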